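/- Let $n\ge 1$ and $r\ge 2$ be integers and let $X_1,\dots,X_n$ be independent random vectors with values in $\{0,1\}^r$ whose components sum up to one. Let $X$ be the random $r\times n$ matrix with columns $X_1,\dots,X_n$ and let $s=\mathbb{E}_s X$ be its expectation, where $\mathbb{E}_s$ denotes the underlying expectation. Equip the $r\times n$ matrices with the inner product $\langle t,t'\rangle=\sum_{i,j}t_i^{(j)}t_i'^{(j)}$, where $t_i^{(j)}$ is the entry of $t$ in line $j$ and column $i$, and with the associated norm $\|\cdot\|$; for a linear subspace $S$ of $\mathbb{R}^n$ let $\mathbb{R}^r\otimes S$ be the set of $r\times n$ matrices whose lines all belong to $S$. Let $\{S_m, m\in\mathcal{M}\}$ be a finite nonempty collection of linear subspaces of $\mathbb{R}^n$ with dimensions $D_m\ge 1$. For $m\in\mathcal{M}$ let $\hat s_m$ and $\bar s_m$ be the orthogonal projections of $X$ and of $s$ onto $\mathbb{R}^r\otimes S_m$. Let $\mathrm{pen}:\mathcal{M}\to[0,\infty)$ satisfy $$\mathrm{pen}(m)\ge K D_m\bigl(1+2\sqrt{2L_m}\bigr)^2\qquad\text{for all } m\in\mathcal{M}$$ for some $K>1$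 and some positive numbers $L_m$. Let $\gamma_n(t)=\|t\|^2-2\langle X,t\rangle$, let $\hat m$ be a (measurable) minimizer of $\gamma_n(\hat s_m)+\mathrm{pen}(m)$ over $m\in\mathcal{M}$, and let $\tilde s=\hat s_{\hat m}$. Then $\|s-\tilde s\|^2$ is integrable and $$\mathbb{E}_s\|s-\tilde s\|^2\le \frac{2K(K+1)^2}{(K-1)^3}\,\inf_{m\in\mathcal{M}}\bigl\{\|s-\bar s_m\|^2+\mathrm{pen}(m)\bigr\}+16K\Bigl(\frac{K+1}{K-1}\Bigr)^3\Sigma,\qquad \Sigma=\sum_{m\in\mathcal{M}}\exp(-L_mD_m).$$ -/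

import Mathlib

open MeasureTheory ProbabilityTheory

noncomputable section

namespace MultinomialSelection

/-- Real matrices with `r` lines and `n` columns; the entry in line `j` and column `i` is `t (j, i)`.
The inner product is the sum over all entries of the products of the entries,
and the norm is the associated one. -/
abbrev Mat (r n : ℕ) : Type := EuclideanSpace ℝ (Fin r × Fin n)

/-- The `j`-th line of a matrix, as a vector of the Euclidean space of dimension `n`. -/
def line {r n : ℕ} (t : Mat r n) (j : Fin r) : EuclideanSpace ℝ (Fin n) :=
  WithLp.toLp 2 (fun i => t (j, i))

/-- The space of all matrices with `r` lines, each of which belongs to `S`. -/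
def tensorSpace (r : ℕ) {n : ℕ} (S : Submodule ℝ (EuclideanSpace ℝ (Fin n))) :
    Submodule ℝ (Mat r n) where
  carrier := {t | ∀ j, line t j ∈ S}
  add_mem' := fun ha hb j => S.add_mem (ha j) (hb j)
  zero_mem' := fun _ => S.zero_mem
  smul_mem' := fun c _ ha j => S.smul_mem c (ha j)

/-- The orthogonal projection of a matrix onto the space of matrices with lines in `S`.
Applied to the data matrix it is the least-squares estimator on that space. -/
def proj {r n : ℕ} (S : Submodule ℝ (EuclideanSpace ℝ (Fin n))) (t : Mat r n) : Mat r n :=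
  (tensorSpace r S).starProjection t

/-- The random matrix whose `i`-th column is the `i`-th observation. -/
def dataMatrix {Ω : Type*} {r n : ℕ} (X : Fin n → Ω → Fin r → ℝ) (ω : Ω) : Mat r n :=
  WithLp.toLp 2 (fun p => X p.2 ω p.1)

/-- The expectation of the data matrix, entry by entry. -/
def meanMatrix {Ω : Type*} [MeasurableSpace Ω] {r n : ℕ} (P : Measure Ω)
    (X : Fin n → Ω → Fin r → ℝ) : Mat r n :=
  WithLp.toLp 2 (fun p => ∫ ω, X p.2 ω p.1 ∂P)

/-- The least-squares contrast of `t` for the data `x`. -/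
def contrast {r n : ℕ} (x t : Mat r n) : ℝ := ‖t‖ ^ 2 - 2 * inner ℝ x t

/-- The index `k` minimizes the penalized least-squares contrast for the data `x`. -/
def IsSelected {r n : ℕ} {ι : Type*} (S : ι → Submodule ℝ (EuclideanSpace ℝ (Fin n)))
    (pen : ι → ℝ) (x : Mat r n) (k : ι) : Prop :=
  ∀ m, contrast x (proj (S k) x) + pen k ≤ contrast x (proj (S m) x) + pen m

end MultinomialSelection

end

/-! Write `s` for the mean of the data `x`, `ε = x - s` for the noise, and `D`, `L` for the dimension
and the weight of a model `S`.

For the selected model, minimality gives `‖s - s̃‖ ^ 2` at most `‖s - s̄_m‖ ^ 2 + pen m`, plus the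
centred term `2 * ⟨ε, s - s̄_m⟩`, plus `2 * ⟨ε, s̃ - s⟩`, minus the penalty of the selected model. The
error `s̃ - s` belongs to the space `extendedSpace S s` spanned by `s` and the matrices with lines
in `S`. Let `f` be the norm of the projection of `ε` onto this space. Young's inequality bounds
`2 * ⟨ε, s̃ - s⟩` by a part of the left-hand side plus `(K + 1) / 2 * f ^ 2`
(`IsSelected.norm_sq_le`), and as `K` is larger than `(K + 1) / 2`, the penalty absorbs `f ^ 2` up
to a constant and the squared excess of `f` over `√D * (1 + 2 * √(2 * L)) + 1 / 2`
(`sq_overflow_le`). The constant is at most a multiple of `pen m`. The excess is summed over all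
models, so it has to be at most `8 * exp (-(L * D))` in expectation
(`integral_overflow_extendedSpace_le`).

The latter rests on two facts about `f`. Its second moment is at most `D + 1`: each column of the
mean sums up to one, so that `S` contributes at most `D`, and the additional line at most one
(`integral_norm_sq_extendedSpace_le`). And `f` is a convex 1-Lipschitz function of independent
columns, each taking its values in a set of diameter at most `√2`. For such functions Maurey's convex
property (τ) (`convex_property_tau`) gives the exponential moment bound
`E exp (l * f) ≤ exp (2 * l ^ 2 + l * √(D + 1))`, with the constant `2` that matches the penalty
(`integral_exp_norm_le_of_sq`). Property (τ) is proved by induction on the number of columns, over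
finite sums, since the law of the data is a product of finitely supported measures
(`integral_comp_dataMatrix`). -/

noncomputable section

namespace MultinomialSelection

/-! ### The convex property (τ) for products of finitely supported measures -/

lemma exp_sub_sq_add_exp_neg_le_two {u : ℝ} (h0 : 0 ≤ u) (h2 : u ≤ 2) :
    Real.exp (u - u ^ 2) + Real.exp (-u) ≤ 2 := by
  have h1 : Real.exp (u - u ^ 2) + Real.exp (-u) =
      2 * Real.exp (-u ^ 2 / 2) * Real.cosh (u - u ^ 2 / 2) := by
    have e1 : u - u ^ 2 = -u ^ 2 / 2 + (u - u ^ 2 / 2) := by ring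
    have e2 : -u = -u ^ 2 / 2 + -(u - u ^ 2 / 2) := by ring
    rw [Real.cosh_eq, e1, e2, Real.exp_add, Real.exp_add]
    ring
  rw [h1]
  have h3 := Real.cosh_le_exp_half_sq (u - u ^ 2 / 2)
  have h4 : Real.exp (-u ^ 2 / 2) * Real.cosh (u - u ^ 2 / 2) ≤ 1 := by
    calc _ ≤ Real.exp (-u ^ 2 / 2) * Real.exp ((u - u ^ 2 / 2) ^ 2 / 2) := by gcongr
      _ = Real.exp (-u ^ 2 / 2 + (u - u ^ 2 / 2) ^ 2 / 2) := (Real.exp_add _ _).symm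
      _ ≤ 1 := by
        rw [Real.exp_le_one_iff]
        have : (u - u ^ 2 / 2) ^ 2 ≤ u ^ 2 := by
          apply pow_le_pow_left₀ <;> nlinarith
        linarith
  linarith

/-- With the best `θ = min (2 * u) 1`, the exponent `g` is at most `u - u ^ 2` for `u ≤ 1 / 2` and
at most `1 / 4` otherwise. -/
lemma exp_add_exp_neg_le_two_of_forall {u g : ℝ} (h0 : 0 ≤ u)
    (hg : ∀ θ : ℝ, 0 ≤ θ → θ ≤ 1 → g ≤ (1 - θ) * u + θ ^ 2 / 4) :
    Real.exp g + Real.exp (-u) ≤ 2 := by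
  by_cases hu : u ≤ 1 / 2
  · have h1 := hg (2 * u) (by linarith) (by linarith)
    have h2 : g ≤ u - u ^ 2 := by nlinarith
    have := Real.exp_le_exp.2 h2
    have := exp_sub_sq_add_exp_neg_le_two h0 (by linarith)
    linarith
  · have h1 := hg 1 (by norm_num) le_rfl
    have h2 : g ≤ 1 / 2 - (1 / 2) ^ 2 := by linarith
    have h3 := Real.exp_le_exp.2 h2
    have h4 : Real.exp (-u) ≤ Real.exp (-(1 / 2)) := Real.exp_le_exp.2 (by linarith)
    have := exp_sub_sq_add_exp_neg_le_two (u := 1 / 2) (by norm_num) (by norm_num)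
    linarith

/-- The one-coordinate case of the convex property (τ). Let `F` be minimal at `a k` among the atoms
`a j`, and `u = F (a j) - F (a k)`. Testing the hypothesis at points of the segment from `a j` to
`a k` gives `exp (G j - F (a k)) ≤ 2 - exp (-u)`, and it remains to use `(2 - T) * T ≤ 1`. -/
theorem convex_property_tau_single {V J : Type*} [NormedAddCommGroup V] [NormedSpace ℝ V]
    [Fintype J] (a : J → V) (ha : ∀ j k, ‖a j - a k‖ ^ 2 ≤ 2) (w : J → ℝ) (hw : ∀ j, 0 ≤ w j)
    (hw1 : ∑ j, w j = 1) (F : V → ℝ) (hF : ConvexOn ℝ Set.univ F) (G : J → ℝ)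
    (hG : ∀ j x, G j ≤ F x + ‖a j - x‖ ^ 2 / 8) :
    (∑ j, w j * Real.exp (G j)) * ∑ j, w j * Real.exp (-F (a j)) ≤ 1 := by
  have hJ : Nonempty J := by
    by_contra h
    rw [not_nonempty_iff] at h
    simp at hw1
  obtain ⟨k, hk⟩ := Finite.exists_min (fun j => F (a j))
  have key : ∀ j, Real.exp (G j - F (a k)) + Real.exp (-(F (a j) - F (a k))) ≤ 2 := by
    intro j
    apply exp_add_exp_neg_le_two_of_forall (sub_nonneg.2 (hk j))
    intro θ h0 h1
    have h2 := hG j ((1 - θ) • a j + θ • a k)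
    have h3 := hF.2 (Set.mem_univ (a j)) (Set.mem_univ (a k)) (sub_nonneg.2 h1) h0 (by ring)
    have h4 : a j - ((1 - θ) • a j + θ • a k) = θ • (a j - a k) := by module
    rw [h4, norm_smul, mul_pow, Real.norm_eq_abs, sq_abs] at h2
    simp only [smul_eq_mul] at h3
    nlinarith [mul_le_mul_of_nonneg_left (ha j k) (sq_nonneg θ)]
  set T := ∑ j, w j * Real.exp (-(F (a j) - F (a k))) with hT
  have hT0 : 0 ≤ T := Finset.sum_nonneg fun j _ => mul_nonneg (hw j) (Real.exp_pos _).le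
  have h1 : ∑ j, w j * Real.exp (G j - F (a k)) ≤ 2 - T := by
    have : ∑ j, w j * (Real.exp (G j - F (a k)) + Real.exp (-(F (a j) - F (a k)))) ≤
        ∑ j, w j * 2 := Finset.sum_le_sum fun j _ => mul_le_mul_of_nonneg_left (key j) (hw j)
    simp only [mul_add, Finset.sum_add_distrib, ← Finset.sum_mul, hw1] at this
    linarith
  have h2 : ∑ j, w j * Real.exp (G j) =
      Real.exp (F (a k)) * ∑ j, w j * Real.exp (G j - F (a k)) := by
    rw [Finset.mul_sum]
    refine Finset.sum_congr rfl fun j _ => ?_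
    rw [mul_left_comm, ← Real.exp_add]; ring_nf
  have h3 : ∑ j, w j * Real.exp (-F (a j)) = Real.exp (-F (a k)) * T := by
    rw [hT, Finset.mul_sum]
    refine Finset.sum_congr rfl fun j _ => ?_
    rw [mul_left_comm, ← Real.exp_add]; ring_nf
  rw [h2, h3, mul_mul_mul_comm, ← Real.exp_add, add_neg_cancel, Real.exp_zero, one_mul]
  nlinarith [mul_le_mul_of_nonneg_right h1 hT0, sq_nonneg (T - 1)]

lemma sum_mul_exp_pos {I : Type*} [Fintype I] {w : I → ℝ} (hw : ∀ i, 0 ≤ w i)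
    (hw1 : 0 < ∑ i, w i) (p : I → ℝ) : 0 < ∑ i, w i * Real.exp (p i) := by
  obtain ⟨i, -, hi⟩ := Finset.exists_lt_of_sum_lt (s := Finset.univ) (f := fun _ : I => (0 : ℝ))
    (g := w) (by simpa using hw1)
  exact Finset.sum_pos' (fun i _ => mul_nonneg (hw i) (Real.exp_pos _).le)
    ⟨i, Finset.mem_univ _, mul_pos hi (Real.exp_pos _)⟩

theorem convexOn_log_sum_exp {V I : Type*} [AddCommGroup V] [Module ℝ V] [Fintype I] {w : I → ℝ}
    (hw : ∀ i, 0 ≤ w i) (hw1 : 0 < ∑ i, w i) {f : I → V → ℝ}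
    (hf : ∀ i, ConvexOn ℝ Set.univ (f i)) :
    ConvexOn ℝ Set.univ fun x => Real.log (∑ i, w i * Real.exp (f i x)) := by
  have hpos := sum_mul_exp_pos hw hw1
  -- Convexity of `exp` at `f i x - log A` and `f i y - log B` makes the weights sum to `α + β = 1`.
  refine ⟨convex_univ, fun x _ y _ α β hα hβ hαβ => ?_⟩
  set A := ∑ i, w i * Real.exp (f i x) with hA
  set B := ∑ i, w i * Real.exp (f i y) with hB
  have hA0 : 0 < A := hpos _
  have hB0 : 0 < B := hpos _
  simp only [smul_eq_mul]
  rw [Real.log_le_iff_le_exp (hpos _)]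
  have h1 : ∀ i, Real.exp (f i (α • x + β • y)) ≤ Real.exp (α * Real.log A + β * Real.log B) *
      (α * (Real.exp (f i x) / A) + β * (Real.exp (f i y) / B)) := by
    intro i
    have h2 := (hf i).2 (Set.mem_univ x) (Set.mem_univ y) hα hβ hαβ
    have h3 := convexOn_exp.2 (Set.mem_univ (f i x - Real.log A))
      (Set.mem_univ (f i y - Real.log B)) hα hβ hαβ
    rw [Real.exp_sub, Real.exp_sub, Real.exp_log hA0, Real.exp_log hB0] at h3
    simp only [smul_eq_mul] at h2 h3
    calc Real.exp (f i (α • x + β • y))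
        ≤ Real.exp ((α * Real.log A + β * Real.log B) +
          (α * (f i x - Real.log A) + β * (f i y - Real.log B))) :=
          Real.exp_le_exp.2 (by linarith)
      _ = _ * _ := Real.exp_add _ _
      _ ≤ _ := by gcongr
  calc ∑ i, w i * Real.exp (f i (α • x + β • y))
      ≤ ∑ i, w i * (Real.exp (α * Real.log A + β * Real.log B) *
      (α * (Real.exp (f i x) / A) + β * (Real.exp (f i y) / B))) :=
        Finset.sum_le_sum fun i _ => mul_le_mul_of_nonneg_left (h1 i) (hw i)
    _ = Real.exp (α * Real.log A + β * Real.log B) * (α * (A / A) + β * (B / B)) := by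
        conv_rhs => rw [hA, hB]
        rw [Finset.sum_div, Finset.sum_div, Finset.mul_sum, Finset.mul_sum,
          ← Finset.sum_add_distrib, Finset.mul_sum]
        refine Finset.sum_congr rfl fun i _ => ?_
        ring
    _ = _ := by rw [div_self hA0.ne', div_self hB0.ne', mul_one, mul_one, hαβ, mul_one]

/-- Partial minimization preserves convexity; the bound from below keeps the real infimum
meaningful. -/
theorem convexOn_iInf_of_jointly_convex {V W : Type*} [AddCommGroup V] [Module ℝ V]
    [AddCommGroup W] [Module ℝ W] {H : V → W → ℝ} (h0 : ∀ x y, 0 ≤ H x y)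
    (hH : ConvexOn ℝ Set.univ fun p : V × W => H p.1 p.2) :
    ConvexOn ℝ Set.univ fun x => ⨅ y, H x y := by
  refine ⟨convex_univ, fun x _ y _ α β hα hβ hαβ => ?_⟩
  simp only [smul_eq_mul]
  rw [Real.mul_iInf_of_nonneg hα, Real.mul_iInf_of_nonneg hβ]
  refine le_ciInf_add_ciInf fun u v => ?_
  have h1 := hH.2 (Set.mem_univ (x, u)) (Set.mem_univ (y, v)) hα hβ hαβ
  refine (ciInf_le ⟨0, ?_⟩ (α • u + β • v)).trans h1
  rintro _ ⟨z, rfl⟩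
  exact h0 _ _

lemma sum_fin_succ_fun {n : ℕ} {J : Type*} [Fintype J] (g : (Fin (n + 1) → J) → ℝ) :
    ∑ κ, g κ = ∑ j, ∑ κ' : Fin n → J, g (Fin.cons j κ') := by
  rw [← Fintype.sum_prod_type' (f := fun j κ' => g (Fin.cons j κ'))]
  exact (Fintype.sum_equiv (Fin.consEquiv fun _ => J) _ _ fun _ => rfl).symm

lemma sum_prod_weights {n : ℕ} {J : Type*} [Fintype J] {w : Fin n → J → ℝ}
    (hw1 : ∀ i, ∑ j, w i j = 1) : ∑ κ : Fin n → J, ∏ i, w i (κ i) = 1 := by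
  classical
  rw [← Fintype.prod_sum]
  simp [hw1]

/-- The convex property (τ) of Maurey for products of finitely supported probability measures with
supports of squared diameter at most `2`: if `G` is at most the infimum-convolution of the convex
function `F` with `‖·‖ ^ 2 / 8`, the exponential moments of `G` and `-F` have product at most `1`.

In the inductive step, `Q κ x` is the infimum-convolution of `F` in all coordinates but the first,
which is held at `x`. Its log-exponential moment `g` is convex in `x`, so that the one-coordinate
case applies to `g`, and the induction hypothesis bounds the exponential moments of `-F`
by `exp (-g)`. -/
theorem convex_property_tau {V J : Type*} [NormedAddCommGroup V] [NormedSpace ℝ V] [Fintype J] :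
    ∀ {n : ℕ} (a : Fin n → J → V) (_ : ∀ i j k, ‖a i j - a i k‖ ^ 2 ≤ 2) (w : Fin n → J → ℝ)
    (_ : ∀ i j, 0 ≤ w i j) (_ : ∀ i, ∑ j, w i j = 1) (F : (Fin n → V) → ℝ)
    (_ : ConvexOn ℝ Set.univ F) (_ : ∀ x, 0 ≤ F x) (G : (Fin n → J) → ℝ)
    (_ : ∀ κ x, G κ ≤ F x + (∑ i, ‖a i (κ i) - x i‖ ^ 2) / 8),
    (∑ κ : Fin n → J, (∏ i, w i (κ i)) * Real.exp (G κ)) *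
      ∑ κ : Fin n → J, (∏ i, w i (κ i)) * Real.exp (-F fun i => a i (κ i)) ≤ 1 := by
  intro n
  induction n with
  | zero =>
    intro a _ w _ _ F _ _ G hG
    simp only [Finset.univ_unique, Finset.sum_singleton, Finset.univ_eq_empty,
      Finset.prod_empty, one_mul, ← Real.exp_add, Real.exp_le_one_iff]
    have := hG default (fun i => a i ((default : Fin 0 → J) i))
    simp only [Finset.univ_eq_empty, Finset.sum_empty, zero_div, add_zero] at this
    linarith
  | succ n ih =>
    intro a ha w hw hw1 F hF hF0 G hG
    set H : (Fin n → J) → V → (Fin n → V) → ℝ := fun κ x y =>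
      F (Fin.cons x y) + (∑ i, ‖a i.succ (κ i) - y i‖ ^ 2) / 8 with hH
    have hH0 : ∀ κ x y, 0 ≤ H κ x y := fun κ x y => add_nonneg (hF0 _) (by positivity)
    have hbdd : ∀ κ x, BddBelow (Set.range (H κ x)) := by
      rintro κ x
      refine ⟨0, ?_⟩
      rintro _ ⟨y, rfl⟩
      exact hH0 κ x y
    set Q : (Fin n → J) → V → ℝ := fun κ x => ⨅ y, H κ x y with hQ
    have hQconv : ∀ κ, ConvexOn ℝ Set.univ (Q κ) := by
      intro κ
      refine convexOn_iInf_of_jointly_convex (hH0 κ) ?_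
      refine ConvexOn.add ?_ ?_
      · refine ⟨convex_univ, ?_⟩
        rintro ⟨x, u⟩ - ⟨y, v⟩ - α β hα hβ hαβ
        have h1 := hF.2 (Set.mem_univ (Fin.cons x u : Fin (n + 1) → V))
          (Set.mem_univ (Fin.cons y v)) hα hβ hαβ
        convert h1 using 2
        funext i
        refine Fin.cases ?_ (fun i => ?_) i <;> simp
      · have h2 : ∀ i, ConvexOn ℝ Set.univ
            fun p : V × (Fin n → V) => ‖a i.succ (κ i) - p.2 i‖ ^ 2 := by
          intro i
          refine ConvexOn.pow ?_ (fun _ _ => norm_nonneg _) 2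
          refine ⟨convex_univ, ?_⟩
          rintro ⟨x, u⟩ - ⟨y, v⟩ - α β hα hβ hαβ
          have h3 : a i.succ (κ i) - (α • (x, u) + β • (y, v)).2 i =
              α • (a i.succ (κ i) - u i) + β • (a i.succ (κ i) - v i) := by
            have : a i.succ (κ i) = α • a i.succ (κ i) + β • a i.succ (κ i) := by
              rw [← add_smul, hαβ, one_smul]
            nth_rewrite 1 [this]
            simp only [Prod.snd_add, Prod.smul_snd, Pi.add_apply, Pi.smul_apply]
            module
          simp only [h3, smul_eq_mul]
          refine (norm_add_le _ _).trans ?_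
          rw [norm_smul, norm_smul, Real.norm_of_nonneg hα, Real.norm_of_nonneg hβ]
        have h4 : ConvexOn ℝ Set.univ
            fun p : V × (Fin n → V) => ∑ i, ‖a i.succ (κ i) - p.2 i‖ ^ 2 := by
          have := Finset.sum_induction (s := (Finset.univ : Finset (Fin n)))
            (fun i (p : V × (Fin n → V)) => ‖a i.succ (κ i) - p.2 i‖ ^ 2)
            (ConvexOn ℝ Set.univ) (fun _ _ hp hq => hp.add hq) (convexOn_const 0 convex_univ)
            (fun i _ => h2 i)
          refine this.congr fun p _ => ?_
          simp only [Finset.sum_apply]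
        have h5 := h4.smul (c := (1 / 8 : ℝ)) (by norm_num)
        refine h5.congr fun p _ => ?_
        simp only [smul_eq_mul]; ring
    set w' : (Fin n → J) → ℝ := fun κ => ∏ i, w i.succ (κ i) with hw'
    have hw'0 : ∀ κ, 0 ≤ w' κ := fun κ => Finset.prod_nonneg fun i _ => hw _ _
    have hw'1 : ∑ κ, w' κ = 1 := sum_prod_weights fun i => hw1 i.succ
    have hpos := sum_mul_exp_pos hw'0 (by rw [hw'1]; exact one_pos)
    have hg := convexOn_log_sum_exp hw'0 (by rw [hw'1]; exact one_pos) hQconv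
    set g : V → ℝ := fun x => Real.log (∑ κ, w' κ * Real.exp (Q κ x)) with hgdef
    have hih : ∀ x, (∑ κ, w' κ * Real.exp (-F (Fin.cons x fun i => a i.succ (κ i)))) ≤
        Real.exp (-g x) := by
      intro x
      have hconv : ConvexOn ℝ Set.univ fun y : Fin n → V => F (Fin.cons x y) := by
        refine ⟨convex_univ, ?_⟩
        rintro u - v - α β hα hβ hαβ
        have h1 := hF.2 (Set.mem_univ (Fin.cons x u : Fin (n + 1) → V))
          (Set.mem_univ (Fin.cons x v)) hα hβ hαβ
        convert h1 using 2
        funext i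
        refine Fin.cases ?_ (fun i => ?_) i <;> simp [← add_smul, hαβ]
      have := ih (fun i => a i.succ) (fun i => ha i.succ) (fun i => w i.succ) (fun i => hw i.succ)
        (fun i => hw1 i.succ) (fun y => F (Fin.cons x y)) hconv (fun y => hF0 _)
        (fun κ => Q κ x) (fun κ y => ciInf_le (hbdd κ x) y)
      rw [Real.exp_neg, hgdef, Real.exp_log (hpos _), le_inv_comm₀ (hpos _) (hpos _),
        ← one_div, le_div_iff₀ (hpos _)]
      exact this
    have hG' : ∀ j x, Real.log (∑ κ, w' κ * Real.exp (G (Fin.cons j κ))) ≤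
        g x + ‖a 0 j - x‖ ^ 2 / 8 := by
      intro j x
      rw [Real.log_le_iff_le_exp (hpos _), Real.exp_add, hgdef, Real.exp_log (hpos _),
        Finset.sum_mul]
      refine Finset.sum_le_sum fun κ _ => ?_
      rw [mul_assoc, ← Real.exp_add]
      refine mul_le_mul_of_nonneg_left (Real.exp_le_exp.2 ?_) (hw'0 κ)
      rw [← sub_le_iff_le_add]
      refine le_ciInf fun y => ?_
      have := hG (Fin.cons j κ) (Fin.cons x y)
      rw [Fin.sum_univ_succ] at this
      simp only [Fin.cons_zero, Fin.cons_succ] at this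
      simp only [hH]
      linarith
    have h1 := convex_property_tau_single (a 0) (ha 0) (w 0) (hw 0) (hw1 0) g hg _ hG'
    simp only [Real.exp_log (hpos _)] at h1
    rw [sum_fin_succ_fun, sum_fin_succ_fun]
    simp only [Fin.prod_univ_succ, Fin.cons_zero, Fin.cons_succ, mul_assoc, ← Finset.mul_sum]
    refine le_trans ?_ h1
    refine mul_le_mul_of_nonneg_left ?_ (Finset.sum_nonneg fun j _ =>
      mul_nonneg (hw _ _) (hpos _).le)
    refine Finset.sum_le_sum fun j _ => mul_le_mul_of_nonneg_left ?_ (hw _ _)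
    refine le_trans (le_of_eq ?_) (hih (a 0 j))
    refine Finset.sum_congr rfl fun κ _ => ?_
    congr 4
    funext i
    refine Fin.cases ?_ (fun i => ?_) i <;> simp

/-! ### Moments and law of the data matrix -/

/-- The observations are independent and take their values in the canonical basis: the entries
are `0` or `1` and sum up to one. -/
structure IsCategoricalSample {Ω : Type*} [MeasurableSpace Ω] (P : Measure Ω) {r n : ℕ}
    (X : Fin n → Ω → Fin r → ℝ) : Prop where
  measurable : ∀ i, Measurable (X i)
  indep : iIndepFun X P
  eq_zero_or_one : ∀ i ω j, X i ω j = 0 ∨ X i ω j = 1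
  sum_eq_one : ∀ i ω, ∑ j, X i ω j = 1

/-- The matrix with given columns. -/
def ofColumns (r n : ℕ) : (Fin n → EuclideanSpace ℝ (Fin r)) →ₗ[ℝ] Mat r n where
  toFun x := WithLp.toLp 2 fun p => x p.2 p.1
  map_add' _ _ := rfl
  map_smul' _ _ := rfl

lemma norm_sq_ofColumns {r n : ℕ} (x : Fin n → EuclideanSpace ℝ (Fin r)) :
    ‖ofColumns r n x‖ ^ 2 = ∑ i, ‖x i‖ ^ 2 := by
  simp only [EuclideanSpace.norm_sq_eq, Fintype.sum_prod_type_right]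
  rfl

lemma inner_dataMatrix_eq {Ω : Type*} {r n : ℕ} {X : Fin n → Ω → Fin r → ℝ} (a : Mat r n)
    (ω : Ω) :
    inner ℝ (dataMatrix X ω) a = ∑ i, ∑ j, a (j, i) * X i ω j := by
  simp only [PiLp.inner_apply, Fintype.sum_prod_type_right, dataMatrix]
  rfl

namespace IsCategoricalSample

variable {Ω : Type*} [MeasurableSpace Ω] {P : Measure Ω} {r n : ℕ} {X : Fin n → Ω → Fin r → ℝ}

lemma exists_eq_single (h : IsCategoricalSample P X) (i : Fin n) (ω : Ω) :
    ∃ k, X i ω = Pi.single k 1 := by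
  have h0 : ∀ j, 0 ≤ X i ω j := fun j => by
    rcases h.eq_zero_or_one i ω j with h | h <;> simp [h]
  obtain ⟨k, hk⟩ : ∃ k, X i ω k = 1 := by
    by_contra! hne
    have := h.sum_eq_one i ω
    rw [Finset.sum_eq_zero fun j _ => (h.eq_zero_or_one i ω j).resolve_right (hne j)] at this
    exact zero_ne_one this
  refine ⟨k, funext fun j => ?_⟩
  by_cases hj : j = k
  · subst hj; simp [hk]
  · rw [Pi.single_eq_of_ne hj]
    have h1 := h.sum_eq_one i ω
    rw [← Finset.add_sum_erase _ _ (Finset.mem_univ k), hk] at h1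
    have h2 := Finset.single_le_sum (f := X i ω) (fun j _ => h0 j)
      (Finset.mem_erase.2 ⟨hj, Finset.mem_univ j⟩)
    linarith [h0 j]

lemma measurable_dataMatrix (h : IsCategoricalSample P X) : Measurable (dataMatrix X) := by
  have : Measurable fun ω => fun p : Fin r × Fin n => X p.2 ω p.1 :=
    measurable_pi_lambda _ fun p => (measurable_pi_apply p.1).comp (h.measurable p.2)
  exact (PiLp.continuous_toLp 2 _).measurable.comp this

lemma norm_dataMatrix_le (h : IsCategoricalSample P X) (ω : Ω) : ‖dataMatrix X ω‖ ≤ n := by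
  have h1 : ‖dataMatrix X ω‖ ^ 2 = n := by
    have h2 : ∀ i, ∑ j, ‖X i ω j‖ ^ 2 = 1 := by
      intro i
      rw [← h.sum_eq_one i ω]
      refine Finset.sum_congr rfl fun j _ => ?_
      rcases h.eq_zero_or_one i ω j with h | h <;> simp [h]
    rw [EuclideanSpace.norm_sq_eq, Fintype.sum_prod_type_right]
    simp only [dataMatrix, h2]
    simp
  have h2 : (n : ℝ) ≤ (n : ℝ) ^ 2 := by
    norm_cast
    exact Nat.le_self_pow two_ne_zero n
  exact (pow_le_pow_iff_left₀ (norm_nonneg _) (Nat.cast_nonneg n) two_ne_zero).1 (h1.le.trans h2)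

lemma integrable_comp [IsProbabilityMeasure P] (h : IsCategoricalSample P X) {Φ : Mat r n → ℝ}
    (hΦ : Continuous Φ) : Integrable (fun ω => Φ (dataMatrix X ω)) P := by
  obtain ⟨C, hC⟩ := (isCompact_closedBall (0 : Mat r n) n).exists_bound_of_continuousOn
    hΦ.continuousOn
  refine Integrable.of_bound (hΦ.measurable.comp h.measurable_dataMatrix).aestronglyMeasurable C
    (Filter.Eventually.of_forall fun ω => hC _ ?_)
  simpa using h.norm_dataMatrix_le ω

lemma integrable_coord [IsProbabilityMeasure P] (h : IsCategoricalSample P X) (i : Fin n)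
    (j : Fin r) : Integrable (fun ω => X i ω j) P :=
  h.integrable_comp (Φ := fun t => t (j, i)) (by fun_prop)

lemma integral_inner_dataMatrix [IsProbabilityMeasure P] (h : IsCategoricalSample P X)
    (a : Mat r n) : ∫ ω, inner ℝ (dataMatrix X ω) a ∂P = inner ℝ (meanMatrix P X) a := by
  simp only [inner_dataMatrix_eq]
  rw [integral_finsetSum _ fun i _ =>
    integrable_finsetSum _ fun j _ => (h.integrable_coord i j).const_mul _]
  simp only [PiLp.inner_apply, Fintype.sum_prod_type_right, meanMatrix]
  refine Finset.sum_congr rfl fun i _ => ?_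
  rw [integral_finsetSum _ fun j _ => (h.integrable_coord i j).const_mul _]
  refine Finset.sum_congr rfl fun j _ => ?_
  rw [integral_const_mul]
  rfl

lemma integral_inner_sub_mean [IsProbabilityMeasure P] (h : IsCategoricalSample P X)
    (a : Mat r n) : ∫ ω, inner ℝ (dataMatrix X ω - meanMatrix P X) a ∂P = 0 := by
  simp only [inner_sub_left]
  rw [integral_sub (h.integrable_comp (Φ := fun t => inner ℝ t a) (by fun_prop))
    (integrable_const _), h.integral_inner_dataMatrix]
  simp

/-- The columns are independent, so the variances add up; as `X i ω` is a basis vector, the square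
of `∑ j, a (j, i) * X i ω j` has no cross terms. -/
theorem integral_inner_sub_mean_sq_le [IsProbabilityMeasure P] (h : IsCategoricalSample P X)
    (a : Mat r n) : ∫ ω, (inner ℝ (dataMatrix X ω - meanMatrix P X) a) ^ 2 ∂P ≤
      ∑ i, ∑ j, a (j, i) ^ 2 * ∫ ω, X i ω j ∂P := by
  set Y : Fin n → Ω → ℝ := fun i ω => ∑ j, a (j, i) * X i ω j with hY
  have hYsq : ∀ i ω, Y i ω ^ 2 = ∑ j, a (j, i) ^ 2 * X i ω j := by
    intro i ω
    obtain ⟨k, hk⟩ := h.exists_eq_single i ω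
    simp [hY, hk, Pi.single_apply]
  have hYm : ∀ i, Measurable (Y i) := fun i => Finset.measurable_fun_sum _ fun j _ =>
    ((measurable_pi_apply j).comp (h.measurable i)).const_mul _
  have hYsqint : ∀ i, Integrable (fun ω => Y i ω ^ 2) P := by
    intro i
    simp only [hYsq]
    exact integrable_finsetSum _ fun j _ => (h.integrable_coord i j).const_mul _
  have hYL2 : ∀ i, MemLp (Y i) 2 P := fun i =>
    (memLp_two_iff_integrable_sq (hYm i).aestronglyMeasurable).2 (hYsqint i)
  have hindep : Set.Pairwise (↑(Finset.univ : Finset (Fin n)))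
      fun i j => IndepFun (Y i) (Y j) P := by
    intro i _ j _ hij
    exact (h.indep.comp (fun i (x : Fin r → ℝ) => ∑ j, a (j, i) * x j)
      (fun i => by fun_prop)).indepFun hij
  have hsum : ∀ ω, inner ℝ (dataMatrix X ω) a = (∑ i, Y i) ω := fun ω => by
    rw [inner_dataMatrix_eq, Finset.sum_apply]
  have hvar : ∫ ω, (inner ℝ (dataMatrix X ω - meanMatrix P X) a) ^ 2 ∂P =
      variance (∑ i, Y i) P := by
    rw [variance_eq_integral (Finset.aemeasurable_sum _ fun i _ => (hYm i).aemeasurable)]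
    simp only [inner_sub_left, ← h.integral_inner_dataMatrix, hsum]
  rw [hvar, IndepFun.variance_sum (fun i _ => hYL2 i) hindep]
  refine Finset.sum_le_sum fun i _ => ?_
  refine (variance_le_expectation_sq (hYm i).aestronglyMeasurable).trans (le_of_eq ?_)
  simp only [Pi.pow_apply, hYsq]
  rw [integral_finsetSum _ fun j _ => (h.integrable_coord i j).const_mul _]
  simp only [integral_const_mul]

lemma integral_coord_le_one [IsProbabilityMeasure P] (h : IsCategoricalSample P X) (i : Fin n)
    (j : Fin r) : ∫ ω, X i ω j ∂P ≤ 1 := by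
  calc ∫ ω, X i ω j ∂P ≤ ∫ _, (1 : ℝ) ∂P := by
        refine integral_mono (h.integrable_coord i j) (integrable_const _) fun ω => ?_
        rcases h.eq_zero_or_one i ω j with h | h <;> simp [h]
    _ = 1 := by simp

lemma sum_integral_coord [IsProbabilityMeasure P] (h : IsCategoricalSample P X) (i : Fin n) :
    ∑ j, ∫ ω, X i ω j ∂P = 1 := by
  rw [← integral_finsetSum _ fun j _ => h.integrable_coord i j]
  simp [h.sum_eq_one]

/-- The law of the data matrix is a product measure on the finite set of matrices whose columns
belong to the canonical basis. -/
theorem integral_comp_dataMatrix [IsProbabilityMeasure P] (h : IsCategoricalSample P X)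
    (Φ : Mat r n → ℝ) : ∫ ω, Φ (dataMatrix X ω) ∂P =
      ∑ κ : Fin n → Fin r, (∏ i, P.real {ω | X i ω = Pi.single (κ i) 1}) *
        Φ (ofColumns r n fun i => EuclideanSpace.single (κ i) 1) := by
  classical
  set A : (Fin n → Fin r) → Set Ω := fun κ => ⋂ i, {ω | X i ω = Pi.single (κ i) 1} with hA
  have hAi : ∀ i (k : Fin r), MeasurableSet {ω | X i ω = Pi.single k 1} := fun i k =>
    h.measurable i (measurableSet_singleton _)
  have hAm : ∀ κ, MeasurableSet (A κ) := fun κ => MeasurableSet.iInter fun i => hAi i _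
  have hPA : ∀ κ, P.real (A κ) = ∏ i, P.real {ω | X i ω = Pi.single (κ i) 1} := by
    intro κ
    simp only [Measure.real]
    rw [← ENNReal.toReal_prod]
    exact congrArg _ (h.indep.meas_iInter fun i =>
      ⟨{Pi.single (κ i) 1}, measurableSet_singleton _, rfl⟩)
  have hdec : ∀ ω, Φ (dataMatrix X ω) = ∑ κ : Fin n → Fin r,
      (A κ).indicator (fun _ => Φ (ofColumns r n fun i => EuclideanSpace.single (κ i) 1)) ω := by
    intro ω
    choose κ hκ using fun i => h.exists_eq_single i ω
    rw [Finset.sum_eq_single κ]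
    · rw [Set.indicator_of_mem (Set.mem_iInter.2 hκ)]
      congr 1
      ext p
      change X p.2 ω p.1 = EuclideanSpace.single (κ p.2) (1 : ℝ) p.1
      simp [hκ, Pi.single_apply]
    · intro κ' _ hne
      refine Set.indicator_of_notMem (fun hmem => hne ?_) _
      funext i
      have h1 : X i ω = Pi.single (κ' i) 1 := Set.mem_iInter.1 hmem i
      rw [hκ i] at h1
      by_contra h2
      have := congrFun h1 (κ i)
      rw [Pi.single_eq_same, Pi.single_eq_of_ne (Ne.symm h2)] at this
      exact one_ne_zero this
    · simp
  simp only [hdec]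
  rw [integral_finsetSum _ fun κ _ => (integrable_const _).indicator (hAm κ)]
  refine Finset.sum_congr rfl fun κ _ => ?_
  rw [integral_indicator_const _ (hAm κ), hPA, smul_eq_mul]

theorem sum_measureReal_single [IsProbabilityMeasure P] (h : IsCategoricalSample P X) (i : Fin n) :
    ∑ k, P.real {ω | X i ω = Pi.single k 1} = 1 := by
  refine (Finset.sum_congr rfl fun k _ => ?_).trans (h.sum_integral_coord i)
  have hm : MeasurableSet {ω | X i ω = Pi.single k 1} :=
    h.measurable i (measurableSet_singleton _)
  have : ∀ ω, X i ω k = ({ω | X i ω = Pi.single k 1} : Set Ω).indicator (fun _ => (1 : ℝ)) ω := by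
    intro ω
    obtain ⟨l, hl⟩ := h.exists_eq_single i ω
    by_cases hk : k = l
    · subst hk
      rw [Set.indicator_of_mem (by exact hl), hl, Pi.single_eq_same]
    · rw [Set.indicator_of_notMem, hl, Pi.single_eq_of_ne hk]
      intro h2
      have := congrFun (hl.symm.trans h2) k
      simp [Pi.single_eq_of_ne hk] at this
  simp only [this]
  rw [integral_indicator_const _ hm, smul_eq_mul, mul_one]

/-! ### Concentration of the norm of a projection of the noise -/

/-- The convex property (τ) for `l * ‖Λ (t - s)‖`, which is convex and `l`-Lipschitz: its
infimum-convolution with `‖·‖ ^ 2 / 8` loses at most `2 * l ^ 2`. -/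
theorem integral_exp_norm_le [IsProbabilityMeasure P] (h : IsCategoricalSample P X)
    (Λ : Mat r n →L[ℝ] Mat r n) (hΛ : ∀ x, ‖Λ x‖ ≤ ‖x‖) (s : Mat r n) {l : ℝ} (hl : 0 ≤ l) :
    (∫ ω, Real.exp (l * ‖Λ (dataMatrix X ω - s)‖) ∂P) *
      (∫ ω, Real.exp (-(l * ‖Λ (dataMatrix X ω - s)‖)) ∂P) ≤ Real.exp (2 * l ^ 2) := by
  have hdist : ∀ (i : Fin n) (j k : Fin r),
      ‖EuclideanSpace.single j (1 : ℝ) - EuclideanSpace.single k (1 : ℝ)‖ ^ 2 ≤ 2 := by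
    intro _ j k
    by_cases hjk : j = k
    · simp [hjk]
    · rw [norm_sub_sq_real, EuclideanSpace.inner_single_left]
      simp [hjk]
      norm_num
  set F : (Fin n → EuclideanSpace ℝ (Fin r)) → ℝ := fun x => l * ‖Λ (ofColumns r n x - s)‖ with hF
  have hconv : ConvexOn ℝ Set.univ F := by
    refine ⟨convex_univ, fun x _ y _ α β hα hβ hαβ => ?_⟩
    have h1 : Λ (ofColumns r n (α • x + β • y) - s) =
        α • Λ (ofColumns r n x - s) + β • Λ (ofColumns r n y - s) := by
      have : s = α • s + β • s := by rw [← add_smul, hαβ, one_smul]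
      nth_rewrite 1 [this]
      rw [← map_smul, ← map_smul, ← map_add, map_add, map_smul, map_smul]
      congr 1
      module
    simp only [hF, h1, smul_eq_mul]
    have h2 := norm_add_le (α • Λ (ofColumns r n x - s)) (β • Λ (ofColumns r n y - s))
    rw [norm_smul, norm_smul, Real.norm_of_nonneg hα, Real.norm_of_nonneg hβ] at h2
    nlinarith [mul_le_mul_of_nonneg_left h2 hl]
  have htau := convex_property_tau (fun (_ : Fin n) (j : Fin r) => EuclideanSpace.single j (1 : ℝ))
    hdist (fun i k => P.real {ω | X i ω = Pi.single k 1}) (fun _ _ => measureReal_nonneg)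
    h.sum_measureReal_single F hconv (fun x => mul_nonneg hl (norm_nonneg _))
    (fun κ => F (fun i => EuclideanSpace.single (κ i) 1) - 2 * l ^ 2) (by
      intro κ x
      have h1 := norm_sq_ofColumns
        (fun i => EuclideanSpace.single (κ i) (1 : ℝ) - x i)
      rw [← h1]
      set a : Fin n → EuclideanSpace ℝ (Fin r) := fun i => EuclideanSpace.single (κ i) (1 : ℝ)
      have h2 : ofColumns r n (fun i => a i - x i) = ofColumns r n a - ofColumns r n x := by
        rw [← map_sub]; rfl
      rw [h2]
      have h3 : ‖Λ (ofColumns r n a - s)‖ ≤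
          ‖Λ (ofColumns r n x - s)‖ + ‖ofColumns r n a - ofColumns r n x‖ := by
        calc _ = ‖Λ (ofColumns r n x - s) + Λ (ofColumns r n a - ofColumns r n x)‖ := by
              rw [← map_add]; congr 2; abel
          _ ≤ _ := (norm_add_le _ _).trans (by gcongr; exact hΛ _)
      simp only [hF]
      nlinarith [mul_le_mul_of_nonneg_left h3 hl,
        sq_nonneg (‖ofColumns r n a - ofColumns r n x‖ - 4 * l)])
  rw [h.integral_comp_dataMatrix fun t => Real.exp (l * ‖Λ (t - s)‖),
    h.integral_comp_dataMatrix fun t => Real.exp (-(l * ‖Λ (t - s)‖))]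
  simp only [Real.exp_sub, ← mul_div_assoc] at htau
  rw [← Finset.sum_div, div_mul_eq_mul_div, div_le_one (Real.exp_pos _)] at htau
  exact htau

/-- Sub-Gaussian bound above `M`, for any `M` dominating the root mean square. The negative
exponential moment is bounded from below by Jensen's inequality, in the form of the tangent of
`exp` at `-(l * M)` together with `f - M ≤ (f ^ 2 - M ^ 2) / (2 * M)`. -/
theorem integral_exp_norm_le_of_sq [IsProbabilityMeasure P] (h : IsCategoricalSample P X)
    (Λ : Mat r n →L[ℝ] Mat r n) (hΛ : ∀ x, ‖Λ x‖ ≤ ‖x‖) (s : Mat r n) {l M : ℝ} (hl : 0 ≤ l)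
    (hM : 0 < M) (hsq : ∫ ω, ‖Λ (dataMatrix X ω - s)‖ ^ 2 ∂P ≤ M ^ 2) :
    ∫ ω, Real.exp (l * ‖Λ (dataMatrix X ω - s)‖) ∂P ≤ Real.exp (2 * l ^ 2 + l * M) := by
  have h1 := h.integral_exp_norm_le Λ hΛ s hl
  have h2 : Real.exp (-(l * M)) ≤ ∫ ω, Real.exp (-(l * ‖Λ (dataMatrix X ω - s)‖)) ∂P := by
    have h3 : ∀ ω, Real.exp (-(l * M)) *
        (1 - l / (2 * M) * (‖Λ (dataMatrix X ω - s)‖ ^ 2 - M ^ 2)) ≤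
        Real.exp (-(l * ‖Λ (dataMatrix X ω - s)‖)) := by
      intro ω
      set f := ‖Λ (dataMatrix X ω - s)‖
      have h4 : Real.exp (-(l * f)) = Real.exp (-(l * M)) * Real.exp (l * M - l * f) := by
        rw [← Real.exp_add]; ring_nf
      rw [h4]
      refine mul_le_mul_of_nonneg_left (le_trans ?_ (Real.add_one_le_exp _)) (Real.exp_pos _).le
      have h5 : l / (2 * M) * (f ^ 2 - M ^ 2) - (l * f - l * M) = l / (2 * M) * (f - M) ^ 2 := by
        field_simp
        ring
      have h6 : 0 ≤ l / (2 * M) * (f - M) ^ 2 := by positivity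
      linarith
    have hi : Integrable (fun ω => ‖Λ (dataMatrix X ω - s)‖ ^ 2) P :=
      h.integrable_comp (Φ := fun t => ‖Λ (t - s)‖ ^ 2) (by fun_prop)
    have hi2 : Integrable (fun ω => l / (2 * M) * (‖Λ (dataMatrix X ω - s)‖ ^ 2 - M ^ 2)) P :=
      (hi.sub (integrable_const (M ^ 2))).const_mul (l / (2 * M))
    have h7 := integral_mono (((integrable_const (1 : ℝ)).sub hi2).const_mul (Real.exp (-(l * M))))
      (h.integrable_comp (Φ := fun t => Real.exp (-(l * ‖Λ (t - s)‖))) (by fun_prop)) h3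
    refine le_trans ?_ h7
    rw [integral_const_mul]
    simp only [Pi.sub_apply]
    rw [integral_sub (integrable_const _) hi2, integral_const_mul,
      integral_sub hi (integrable_const _)]
    simp only [integral_const, probReal_univ, one_smul]
    have h8 : 0 ≤ l / (2 * M) * (M ^ 2 - ∫ ω, ‖Λ (dataMatrix X ω - s)‖ ^ 2 ∂P) :=
      mul_nonneg (by positivity) (sub_nonneg.2 hsq)
    refine le_mul_of_one_le_right (Real.exp_pos _).le ?_
    linarith
  have h3 : 0 ≤ ∫ ω, Real.exp (l * ‖Λ (dataMatrix X ω - s)‖) ∂P :=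
    integral_nonneg fun ω => (Real.exp_pos _).le
  have h4 := (mul_le_mul_of_nonneg_left h2 h3).trans h1
  rw [Real.exp_add, ← div_le_iff₀ (Real.exp_pos _), div_eq_mul_inv, ← Real.exp_neg]
  exact h4

/-- The mean squared excess over `M + ℓ` has a Gaussian decay in `ℓ`. It follows from the
sub-Gaussian bound and `v ^ 2 ≤ exp v` for `v ≥ 0`. -/
theorem integral_overflow_sq_le [IsProbabilityMeasure P] (h : IsCategoricalSample P X)
    (Λ : Mat r n →L[ℝ] Mat r n) (hΛ : ∀ x, ‖Λ x‖ ≤ ‖x‖) (s : Mat r n) {M ℓ : ℝ} (hℓ : 0 ≤ ℓ)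
    (hM : 0 < M) (hsq : ∫ ω, ‖Λ (dataMatrix X ω - s)‖ ^ 2 ∂P ≤ M ^ 2) :
    ∫ ω, max (‖Λ (dataMatrix X ω - s)‖ - M - ℓ) 0 ^ 2 ∂P ≤ 8 * Real.exp (-(ℓ ^ 2 / 8)) := by
  -- `ℓ / 4` minimizes `2 * l ^ 2 - l * ℓ`; the shift keeps `1 / l ^ 2` bounded, and makes the
  -- exponent equal to `1 / 2 - ℓ ^ 2 / 8`.
  set l := (ℓ + 2) / 4 with hldef
  have hl : 0 < l := by positivity
  have hpt : ∀ ω, max (‖Λ (dataMatrix X ω - s)‖ - M - ℓ) 0 ^ 2 ≤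
      1 / l ^ 2 * Real.exp (-(l * (M + ℓ))) * Real.exp (l * ‖Λ (dataMatrix X ω - s)‖) := by
    intro ω
    set u := ‖Λ (dataMatrix X ω - s)‖ - M - ℓ with hu
    have h1 : Real.exp (-(l * (M + ℓ))) * Real.exp (l * ‖Λ (dataMatrix X ω - s)‖) =
        Real.exp (l * u) := by rw [← Real.exp_add, hu]; ring_nf
    rw [mul_assoc, h1, one_div, inv_mul_eq_div, le_div_iff₀ (by positivity)]
    rcases le_total u 0 with h0 | h0
    · rw [max_eq_right h0]; simp [(Real.exp_pos _).le]
    · rw [max_eq_left h0, ← mul_pow, mul_comm u l]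
      have h2 : l * u ≤ Real.exp (l * u / 2) := by
        have h3 := Real.add_one_le_exp (l * u / 4)
        have h4 : Real.exp (l * u / 2) = Real.exp (l * u / 4) ^ 2 := by
          rw [← Real.exp_nat_mul]; congr 1; push_cast; ring
        rw [h4]
        have h5 : 0 ≤ l * u := by positivity
        nlinarith [sq_nonneg (l * u / 4 - 1)]
      calc (l * u) ^ 2 ≤ Real.exp (l * u / 2) ^ 2 := by gcongr
        _ = Real.exp (l * u) := by rw [← Real.exp_nat_mul]; congr 1; push_cast; ring
  have hi : Integrable (fun ω => Real.exp (l * ‖Λ (dataMatrix X ω - s)‖)) P :=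
    h.integrable_comp (Φ := fun t => Real.exp (l * ‖Λ (t - s)‖)) (by fun_prop)
  have h1 := integral_mono (h.integrable_comp
    (Φ := fun t => max (‖Λ (t - s)‖ - M - ℓ) 0 ^ 2) (by fun_prop)) (hi.const_mul _) hpt
  rw [integral_const_mul] at h1
  refine h1.trans ?_
  calc _ ≤ 1 / l ^ 2 * Real.exp (-(l * (M + ℓ))) * Real.exp (2 * l ^ 2 + l * M) := by
        gcongr
        exact h.integral_exp_norm_le_of_sq Λ hΛ s hl.le hM hsq
    _ = 1 / l ^ 2 * (Real.exp (1 / 2) * Real.exp (-(ℓ ^ 2 / 8))) := by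
        rw [mul_assoc, ← Real.exp_add, ← Real.exp_add]
        congr 2
        rw [hldef]; ring
    _ ≤ 4 * (2 * Real.exp (-(ℓ ^ 2 / 8))) := by
        gcongr
        · rw [div_le_iff₀ (by positivity)]
          have : 1 / 2 ≤ l := by rw [hldef]; linarith
          nlinarith
        · have h2 : Real.exp (1 / 2) ^ 2 = Real.exp 1 := by
            rw [← Real.exp_nat_mul]; norm_num
          have h3 := Real.exp_one_lt_d9
          nlinarith [Real.exp_pos (1 / 2)]
    _ = _ := by ring

end IsCategoricalSample

/-! ### Projections onto spaces of matrices with lines in a subspace -/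

/-- The matrix whose `j`-th line is `w` and whose other lines vanish. -/
def lineMatrix {r n : ℕ} (j : Fin r) (w : EuclideanSpace ℝ (Fin n)) : Mat r n :=
  WithLp.toLp 2 fun p => if p.1 = j then w p.2 else 0

lemma inner_lineMatrix {r n : ℕ} (t : Mat r n) (j : Fin r) (w : EuclideanSpace ℝ (Fin n)) :
    inner ℝ t (lineMatrix j w) = inner ℝ (line t j) w := by
  simp [PiLp.inner_apply, Fintype.sum_prod_type, lineMatrix, line]

lemma line_lineMatrix {r n : ℕ} (i j : Fin r) (w : EuclideanSpace ℝ (Fin n)) :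
    line (lineMatrix j w) i = if i = j then w else 0 := by
  ext k
  by_cases h : i = j <;> simp [line, lineMatrix, h]

lemma lineMatrix_mem_tensorSpace {r n : ℕ} {S : Submodule ℝ (EuclideanSpace ℝ (Fin n))}
    (j : Fin r) {w : EuclideanSpace ℝ (Fin n)} (hw : w ∈ S) : lineMatrix j w ∈ tensorSpace r S := by
  intro i
  rw [line_lineMatrix]
  split_ifs
  · exact hw
  · exact S.zero_mem

lemma line_proj {r n : ℕ} (S : Submodule ℝ (EuclideanSpace ℝ (Fin n))) (t : Mat r n) (j : Fin r) :
    line (proj S t) j = S.starProjection (line t j) := by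
  have hmem : proj S t ∈ tensorSpace r S := Submodule.starProjection_apply_mem _ _
  refine (Submodule.eq_starProjection_of_mem_of_inner_eq_zero (hmem j) fun w hw => ?_).symm
  have h1 : line t j - line (proj S t) j = line (t - proj S t) j := rfl
  rw [h1, ← inner_lineMatrix]
  exact Submodule.starProjection_inner_eq_zero _ _ (lineMatrix_mem_tensorSpace j hw)

lemma norm_sq_proj {r n : ℕ} (S : Submodule ℝ (EuclideanSpace ℝ (Fin n))) (t : Mat r n)
    {κ : Type*} [Fintype κ] (b : OrthonormalBasis κ ℝ S) :
    ‖proj S t‖ ^ 2 = ∑ j, ∑ k, inner ℝ t (lineMatrix j (b k : EuclideanSpace ℝ (Fin n))) ^ 2 := by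
  have h1 : ‖proj S t‖ ^ 2 = ∑ j, ‖line (proj S t) j‖ ^ 2 := by
    simp only [EuclideanSpace.norm_sq_eq, Fintype.sum_prod_type]
    rfl
  rw [h1]
  refine Finset.sum_congr rfl fun j _ => ?_
  have h2 : ‖S.starProjection (line t j)‖ = ‖S.orthogonalProjectionOnto (line t j)‖ := rfl
  rw [line_proj, h2, ← b.sum_sq_inner_left]
  refine Finset.sum_congr rfl fun k _ => ?_
  rw [inner_lineMatrix]
  congr 1
  rw [Submodule.coe_inner]
  change inner ℝ (S.starProjection (line t j)) _ = _
  rw [Submodule.inner_starProjection_left_eq_right,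
    Submodule.starProjection_eq_self_iff.2 (b k).2]

/-- For `v = 0` both sides vanish, the right one by division by zero. -/
lemma norm_sq_starProjection_singleton {E : Type*} [NormedAddCommGroup E]
    [InnerProductSpace ℝ E] (v x : E) :
    ‖(Submodule.span ℝ {v}).starProjection x‖ ^ 2 = inner ℝ x v ^ 2 / ‖v‖ ^ 2 := by
  rw [Submodule.starProjection_singleton, norm_smul, mul_pow, Real.norm_eq_abs, sq_abs,
    real_inner_comm]
  by_cases hv : v = 0
  · simp [hv]
  · have : ‖v‖ ≠ 0 := norm_ne_zero_iff.2 hv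
    simp only [RCLike.ofReal_real_eq_id, id]
    field_simp

lemma norm_sq_starProjection_sup_span {E : Type*} [NormedAddCommGroup E] [InnerProductSpace ℝ E]
    [FiniteDimensional ℝ E] (T : Submodule ℝ E) (s x : E) :
    ‖(T ⊔ Submodule.span ℝ {s}).starProjection x‖ ^ 2 = ‖T.starProjection x‖ ^ 2 +
      inner ℝ x (s - T.starProjection s) ^ 2 / ‖s - T.starProjection s‖ ^ 2 := by
  set v := s - T.starProjection s with hv
  have hvT : ∀ w ∈ T, inner ℝ v w = 0 := fun w hw => Submodule.starProjection_inner_eq_zero _ _ hw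
  have hPs : T.starProjection s ∈ T := Submodule.starProjection_apply_mem _ _
  have hPx : T.starProjection x ∈ T := Submodule.starProjection_apply_mem _ _
  have hQx : (Submodule.span ℝ {v}).starProjection x ∈ Submodule.span ℝ {v} :=
    Submodule.starProjection_apply_mem _ _
  have hvU : v ∈ T ⊔ Submodule.span ℝ {s} := Submodule.sub_mem _
    (Submodule.mem_sup_right (Submodule.mem_span_singleton_self s)) (Submodule.mem_sup_left hPs)
  have hspan : ∀ u ∈ Submodule.span ℝ {v}, ∀ w ∈ T, inner ℝ u w = 0 := by
    intro u hu w hw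
    obtain ⟨c, rfl⟩ := Submodule.mem_span_singleton.1 hu
    rw [inner_smul_left, hvT w hw, mul_zero]
  have key : (T ⊔ Submodule.span ℝ {s}).starProjection x =
      T.starProjection x + (Submodule.span ℝ {v}).starProjection x := by
    refine Submodule.eq_starProjection_of_mem_of_inner_eq_zero
      (Submodule.add_mem _ (Submodule.mem_sup_left hPx) ?_) fun w hw => ?_
    · exact (Submodule.span_singleton_le_iff_mem _ _).2 hvU hQx
    · obtain ⟨t, ht, u, hu, rfl⟩ := Submodule.mem_sup.1 hw
      obtain ⟨c, rfl⟩ := Submodule.mem_span_singleton.1 hu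
      have e1 : t + c • s = (t + c • T.starProjection s) + c • v := by rw [hv]; module
      have ht' : t + c • T.starProjection s ∈ T := T.add_mem ht (T.smul_mem c hPs)
      rw [e1, inner_add_right, ← sub_sub, inner_sub_left,
        Submodule.starProjection_inner_eq_zero _ _ ht', hspan _ hQx _ ht', inner_smul_right,
        sub_right_comm, inner_sub_left, Submodule.starProjection_inner_eq_zero _ _
          (Submodule.mem_span_singleton_self v), real_inner_comm, hvT _ hPx]
      simp
  have h1 := norm_add_sq_eq_norm_sq_add_norm_sq_real
    ((real_inner_comm _ _).trans (hspan _ hQx _ hPx))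
  rw [key, ← norm_sq_starProjection_singleton, sq, h1, sq, sq]

/-- The space of matrices spanned by `s` and the matrices with lines in `S`. It contains the
estimation error of every estimator of `s` with lines in `S`. -/
def extendedSpace {r n : ℕ} (S : Submodule ℝ (EuclideanSpace ℝ (Fin n))) (s : Mat r n) :
    Submodule ℝ (Mat r n) :=
  tensorSpace r S ⊔ Submodule.span ℝ {s}

/-! ### Second moments of the projected noise -/

namespace IsCategoricalSample

variable {Ω : Type*} [MeasurableSpace Ω] {P : Measure Ω} {r n : ℕ} {X : Fin n → Ω → Fin r → ℝ}

/-- Summed over the lines, the squared coordinates along a unit vector of `S` contribute at most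
`1`, because the entries of each column of the mean sum up to one. -/
theorem integral_norm_sq_proj_le [IsProbabilityMeasure P] (h : IsCategoricalSample P X)
    (S : Submodule ℝ (EuclideanSpace ℝ (Fin n))) :
    ∫ ω, ‖proj S (dataMatrix X ω - meanMatrix P X)‖ ^ 2 ∂P ≤ Module.finrank ℝ S := by
  set b := stdOrthonormalBasis ℝ S
  have hi : ∀ j k, Integrable (fun ω => inner ℝ (dataMatrix X ω - meanMatrix P X)
      (lineMatrix j (b k : EuclideanSpace ℝ (Fin n))) ^ 2) P := fun j k =>
    h.integrable_comp (Φ := fun t => inner ℝ (t - meanMatrix P X)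
      (lineMatrix j (b k : EuclideanSpace ℝ (Fin n))) ^ 2) (by fun_prop)
  simp only [fun t => norm_sq_proj S t b]
  rw [integral_finsetSum _ fun j _ => integrable_finsetSum _ fun k _ => hi j k]
  simp only [fun j => integral_finsetSum Finset.univ fun k _ => hi j k]
  rw [Finset.sum_comm]
  have hk : ∀ k, ∑ j, ∫ ω, inner ℝ (dataMatrix X ω - meanMatrix P X)
      (lineMatrix j (b k : EuclideanSpace ℝ (Fin n))) ^ 2 ∂P ≤ 1 := by
    intro k
    calc _ ≤ ∑ j, ∑ i, (b k : EuclideanSpace ℝ (Fin n)) i ^ 2 * ∫ ω, X i ω j ∂P := by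
          refine Finset.sum_le_sum fun j _ => (h.integral_inner_sub_mean_sq_le _).trans ?_
          refine Finset.sum_le_sum fun i _ => le_of_eq ?_
          simp [lineMatrix, ite_pow]
      _ = ∑ i, (b k : EuclideanSpace ℝ (Fin n)) i ^ 2 := by
          rw [Finset.sum_comm]
          simp only [← Finset.mul_sum, h.sum_integral_coord, mul_one]
      _ = ‖(b k : EuclideanSpace ℝ (Fin n))‖ ^ 2 := by
          simp [EuclideanSpace.norm_sq_eq]
      _ ≤ 1 := by
          have : ‖(b k : EuclideanSpace ℝ (Fin n))‖ = 1 := b.norm_eq_one k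
          simp [this]
  refine (Finset.sum_le_sum fun k _ => hk k).trans ?_
  simp

theorem integral_inner_sub_mean_sq_le_norm [IsProbabilityMeasure P]
    (h : IsCategoricalSample P X) (a : Mat r n) :
    ∫ ω, (inner ℝ (dataMatrix X ω - meanMatrix P X) a) ^ 2 ∂P ≤ ‖a‖ ^ 2 := by
  refine (h.integral_inner_sub_mean_sq_le a).trans ?_
  rw [EuclideanSpace.norm_sq_eq, Fintype.sum_prod_type_right]
  refine Finset.sum_le_sum fun i _ => Finset.sum_le_sum fun j _ => ?_
  rw [Real.norm_eq_abs, sq_abs]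
  exact mul_le_of_le_one_right (sq_nonneg _) (h.integral_coord_le_one i j)

theorem integral_norm_sq_extendedSpace_le [IsProbabilityMeasure P] (h : IsCategoricalSample P X)
    (S : Submodule ℝ (EuclideanSpace ℝ (Fin n))) (s : Mat r n) :
    ∫ ω, ‖(extendedSpace S s).starProjection (dataMatrix X ω - meanMatrix P X)‖ ^ 2 ∂P ≤
      Module.finrank ℝ S + 1 := by
  simp only [extendedSpace, norm_sq_starProjection_sup_span]
  set v := s - (tensorSpace r S).starProjection s
  rw [integral_add
    (h.integrable_comp
      (Φ := fun t => ‖(tensorSpace r S).starProjection (t - meanMatrix P X)‖ ^ 2) (by fun_prop))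
    (h.integrable_comp
      (Φ := fun t => inner ℝ (t - meanMatrix P X) v ^ 2 / ‖v‖ ^ 2) (by fun_prop)),
    integral_div]
  refine add_le_add (h.integral_norm_sq_proj_le S) ?_
  exact div_le_one_of_le₀ (h.integral_inner_sub_mean_sq_le_norm v) (sq_nonneg _)

end IsCategoricalSample

/-! ### The oracle inequality -/

lemma norm_sub_proj_le {r n : ℕ} (S : Submodule ℝ (EuclideanSpace ℝ (Fin n))) (x : Mat r n)
    {t : Mat r n} (ht : t ∈ tensorSpace r S) : ‖x - proj S x‖ ^ 2 ≤ ‖x - t‖ ^ 2 := by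
  have hmem : proj S x ∈ tensorSpace r S := Submodule.starProjection_apply_mem _ _
  have h1 : inner ℝ (x - proj S x) (proj S x - t) = 0 :=
    Submodule.starProjection_inner_eq_zero _ _ ((tensorSpace r S).sub_mem hmem ht)
  have h2 : x - t = (x - proj S x) + (proj S x - t) := by abel
  rw [h2, norm_add_sq_real, h1]
  nlinarith [sq_nonneg ‖proj S x - t‖]

lemma contrast_eq {r n : ℕ} (x t : Mat r n) : contrast x t = ‖x - t‖ ^ 2 - ‖x‖ ^ 2 := by
  rw [contrast, norm_sub_sq_real]; ring

/-- The deterministic part of the oracle inequality, for data `x` with mean `s`. The noise term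
`2 * ⟨x - s, q⟩`, with `q` the error of the selected estimator, is split by Young's inequality into
`2 / (K + 1) * ‖q‖ ^ 2`, which goes to the left-hand side, and a term that the penalty has to
dominate. -/
theorem IsSelected.norm_sq_le {r n : ℕ} {ι : Type*}
    {S : ι → Submodule ℝ (EuclideanSpace ℝ (Fin n))} {pen : ι → ℝ} {x : Mat r n} {k : ι}
    (h : IsSelected S pen x k) (s : Mat r n) (m : ι) {K : ℝ} (hK : 1 < K) :
    (K - 1) / (K + 1) * ‖s - proj (S k) x‖ ^ 2 ≤ ‖s - proj (S m) s‖ ^ 2 + pen m +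
      2 * inner ℝ (x - s) (s - proj (S m) s) +
      ((K + 1) / 2 * ‖(extendedSpace (S k) s).starProjection (x - s)‖ ^ 2 - pen k) := by
  have h1 := h m
  rw [contrast_eq, contrast_eq] at h1
  have h2 := norm_sub_proj_le (S m) x (t := proj (S m) s) (Submodule.starProjection_apply_mem _ _)
  have hexp : ∀ t : Mat r n, ‖x - t‖ ^ 2 =
      ‖x - s‖ ^ 2 + 2 * inner ℝ (x - s) (s - t) + ‖s - t‖ ^ 2 := by
    intro t
    rw [← norm_add_sq_real, sub_add_sub_cancel]
  set q := s - proj (S k) x with hq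
  have hqU : q ∈ extendedSpace (S k) s := Submodule.sub_mem _
    (Submodule.mem_sup_right (Submodule.mem_span_singleton_self s))
    (Submodule.mem_sup_left (Submodule.starProjection_apply_mem _ _))
  set f := (extendedSpace (S k) s).starProjection (x - s) with hf
  have h3 : inner ℝ (x - s) q = inner ℝ f q := by
    rw [hf, Submodule.inner_starProjection_left_eq_right,
      Submodule.starProjection_eq_self_iff.2 hqU]
  have h4 : -(‖f‖ * ‖q‖) ≤ inner ℝ f q := by
    have := abs_real_inner_le_norm f q
    exact (abs_le.1 this).1
  rw [hexp (proj (S k) x), ← hq, h3] at h1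
  rw [hexp (proj (S m) s)] at h2
  have hK1 : 0 < K + 1 := by linarith
  have h5 : 2 * (‖f‖ * ‖q‖) ≤ 2 / (K + 1) * ‖q‖ ^ 2 + (K + 1) / 2 * ‖f‖ ^ 2 := by
    have h6 : 2 / (K + 1) * ‖q‖ ^ 2 + (K + 1) / 2 * ‖f‖ ^ 2 - 2 * (‖f‖ * ‖q‖) =
        2 / (K + 1) * (‖q‖ - (K + 1) / 2 * ‖f‖) ^ 2 := by field_simp; ring
    have h7 : 0 ≤ 2 / (K + 1) * (‖q‖ - (K + 1) / 2 * ‖f‖) ^ 2 := by positivity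
    linarith
  have h8 : (K - 1) / (K + 1) = 1 - 2 / (K + 1) := by field_simp; ring
  rw [h8]
  linarith

/-- The factor `K` of the penalty exceeds `(K + 1) / 2`, so `f ^ 2` is compensated up to the square
of the excess of `f` over `z`, which is then split around `1 / 2`. -/
lemma sq_overflow_le {K f z : ℝ} (hK : 1 < K) (hf : 0 ≤ f) :
    (K + 1) / 2 * f ^ 2 - K * z ^ 2 ≤
      K * (K + 1) / (K - 1) * (1 / 2 + 2 * max (f - z - 1 / 2) 0 ^ 2) := by
  have hK1 : 0 < K - 1 := by linarith
  rcases le_total f z with hfz | hfz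
  · have h1 : (K + 1) / 2 * f ^ 2 ≤ K * z ^ 2 := by
      have : f ^ 2 ≤ z ^ 2 := by gcongr
      nlinarith [sq_nonneg z]
    have h2 : 0 ≤ K * (K + 1) / (K - 1) * (1 / 2 + 2 * max (f - z - 1 / 2) 0 ^ 2) := by positivity
    linarith
  · have h1 : (K + 1) / 2 * f ^ 2 - K * z ^ 2 ≤ K * (K + 1) / (K - 1) * (f - z) ^ 2 := by
      have h2 : K * (K + 1) / (K - 1) * (f - z) ^ 2 - ((K + 1) / 2 * f ^ 2 - K * z ^ 2) =
          (K - 1) / 2 * (z - (K + 1) / (K - 1) * (f - z)) ^ 2 := by field_simp; ring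
      have h3 : 0 ≤ (K - 1) / 2 * (z - (K + 1) / (K - 1) * (f - z)) ^ 2 := by positivity
      linarith
    refine h1.trans (mul_le_mul_of_nonneg_left ?_ (by positivity))
    rcases le_total (f - z - 1 / 2) 0 with h0 | h0
    · rw [max_eq_right h0]; nlinarith
    · rw [max_eq_left h0]; nlinarith [sq_nonneg (f - z - 1)]

/-- The excess of `‖Π ε‖` over the square root of the penalty level, for `Π` the projection onto the
extended space of `S`. The shift `1 / 2` covers the dimension of the line spanned by `s`, as
`√(D + 1) ≤ √D + 1 / 2` for `D ≥ 1`. -/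
theorem integral_overflow_extendedSpace_le {Ω : Type*} [MeasurableSpace Ω] {P : Measure Ω}
    [IsProbabilityMeasure P] {r n : ℕ} {X : Fin n → Ω → Fin r → ℝ} (h : IsCategoricalSample P X)
    (S : Submodule ℝ (EuclideanSpace ℝ (Fin n))) (hD : 1 ≤ Module.finrank ℝ S) {L : ℝ}
    (hL : 0 < L) (s : Mat r n) :
    ∫ ω, max (‖(extendedSpace S s).starProjection (dataMatrix X ω - meanMatrix P X)‖ -
      Real.sqrt (Module.finrank ℝ S) * (1 + 2 * Real.sqrt (2 * L)) - 1 / 2) 0 ^ 2 ∂P ≤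
      8 * Real.exp (-(L * Module.finrank ℝ S)) := by
  set D : ℝ := (Module.finrank ℝ S : ℝ) with hDdef
  have hD1 : 1 ≤ D := by rw [hDdef]; exact_mod_cast hD
  set U := extendedSpace S s
  have hsd : 1 ≤ Real.sqrt D := Real.one_le_sqrt.2 hD1
  have hsq := Real.sq_sqrt (zero_le_one.trans hD1)
  have hM : Real.sqrt (D + 1) ≤ Real.sqrt D + 1 / 2 :=
    (Real.sqrt_le_left (by positivity)).2 (by nlinarith)
  have h1 := h.integral_overflow_sq_le U.starProjection U.norm_starProjection_apply_le
    (meanMatrix P X) (M := Real.sqrt (D + 1)) (ℓ := Real.sqrt D * (2 * Real.sqrt (2 * L)))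
    (by positivity) (by positivity) (by
      rw [Real.sq_sqrt (by linarith)]
      exact h.integral_norm_sq_extendedSpace_le S s)
  have h2 : (Real.sqrt D * (2 * Real.sqrt (2 * L))) ^ 2 / 8 = L * D := by
    rw [mul_pow, mul_pow, hsq, Real.sq_sqrt (by positivity)]; ring
  rw [h2] at h1
  refine le_trans (integral_mono
    (h.integrable_comp (Φ := fun t => max (‖U.starProjection (t - meanMatrix P X)‖ -
      Real.sqrt D * (1 + 2 * Real.sqrt (2 * L)) - 1 / 2) 0 ^ 2) (by fun_prop))
    (h.integrable_comp (Φ := fun t => max (‖U.starProjection (t - meanMatrix P X)‖ -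
      Real.sqrt (D + 1) - Real.sqrt D * (2 * Real.sqrt (2 * L))) 0 ^ 2) (by fun_prop))
    fun ω => ?_) h1
  refine pow_le_pow_left₀ (le_max_right _ _) (max_le_max_right 0 ?_) 2
  linarith

/-- The risk bound against a fixed index `m`. -/
theorem integral_norm_sq_sub_proj_le {Ω : Type*} [MeasurableSpace Ω] {P : Measure Ω}
    [IsProbabilityMeasure P] {r n : ℕ} {X : Fin n → Ω → Fin r → ℝ} (h : IsCategoricalSample P X)
    {ι : Type*} [Fintype ι] (S : ι → Submodule ℝ (EuclideanSpace ℝ (Fin n)))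
    (hD : ∀ m, 1 ≤ Module.finrank ℝ (S m)) (pen : ι → ℝ) (K : ℝ) (hK : 1 < K)
    (L : ι → ℝ) (hL : ∀ m, 0 < L m)
    (hpen : ∀ m, K * (Module.finrank ℝ (S m) : ℝ) * (1 + 2 * Real.sqrt (2 * L m)) ^ 2 ≤ pen m)
    (mhat : Ω → ι) (hmhat : ∀ ω, IsSelected S pen (dataMatrix X ω) (mhat ω))
    (hint : Integrable (fun ω => ‖meanMatrix P X - proj (S (mhat ω)) (dataMatrix X ω)‖ ^ 2) P)
    (m : ι) :
    ∫ ω, ‖meanMatrix P X - proj (S (mhat ω)) (dataMatrix X ω)‖ ^ 2 ∂P ≤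
      2 * K * (K + 1) ^ 2 / (K - 1) ^ 3 *
        (‖meanMatrix P X - proj (S m) (meanMatrix P X)‖ ^ 2 + pen m) +
      16 * K * ((K + 1) / (K - 1)) ^ 3 *
        ∑ m, Real.exp (-(L m * (Module.finrank ℝ (S m) : ℝ))) := by
  set s := meanMatrix P X with hs
  set Sig := ∑ m, Real.exp (-(L m * (Module.finrank ℝ (S m) : ℝ))) with hSig
  have hK1 : 0 < K - 1 := by linarith
  set g : ι → Mat r n → ℝ := fun k t => max (‖(extendedSpace (S k) s).starProjection (t - s)‖ -
      Real.sqrt (Module.finrank ℝ (S k)) * (1 + 2 * Real.sqrt (2 * L k)) - 1 / 2) 0 ^ 2 with hg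
  have hgint : ∀ k, Integrable (fun ω => g k (dataMatrix X ω)) P := fun k =>
    h.integrable_comp (by fun_prop)
  set B := K * (K + 1) / (K - 1) with hB
  have hB0 : 0 < B := by positivity
  have hpt : ∀ ω, (K - 1) / (K + 1) * ‖s - proj (S (mhat ω)) (dataMatrix X ω)‖ ^ 2 ≤
      (‖s - proj (S m) s‖ ^ 2 + pen m + B / 2) +
      (2 * inner ℝ (dataMatrix X ω - s) (s - proj (S m) s) +
        2 * B * ∑ k, g k (dataMatrix X ω)) := by
    intro ω
    have h1 := (hmhat ω).norm_sq_le s m hK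
    have h2 := sq_overflow_le (f := ‖(extendedSpace (S (mhat ω)) s).starProjection
      (dataMatrix X ω - s)‖) (z := Real.sqrt (Module.finrank ℝ (S (mhat ω))) *
      (1 + 2 * Real.sqrt (2 * L (mhat ω)))) hK (norm_nonneg _)
    have h3 := hpen (mhat ω)
    rw [mul_pow, Real.sq_sqrt (by positivity), ← mul_assoc, ← hB] at h2
    have h4 : g (mhat ω) (dataMatrix X ω) ≤ ∑ k, g k (dataMatrix X ω) :=
      Finset.single_le_sum (f := fun k => g k (dataMatrix X ω)) (fun k _ => sq_nonneg _)
        (Finset.mem_univ _)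
    have h5 := mul_le_mul_of_nonneg_left h4 hB0.le
    simp only [hg] at h5 ⊢
    linarith
  have hi1 : Integrable (fun ω => 2 * inner ℝ (dataMatrix X ω - s) (s - proj (S m) s)) P :=
    h.integrable_comp (Φ := fun t => 2 * inner ℝ (t - s) (s - proj (S m) s)) (by fun_prop)
  have hi2 : Integrable (fun ω => 2 * B * ∑ k, g k (dataMatrix X ω)) P :=
    (integrable_finsetSum _ fun k _ => hgint k).const_mul _
  have hi12 : Integrable (fun ω => 2 * inner ℝ (dataMatrix X ω - s) (s - proj (S m) s) +
      2 * B * ∑ k, g k (dataMatrix X ω)) P := hi1.add hi2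
  have h1 := integral_mono (hint.const_mul _) ((integrable_const _).add hi12) hpt
  rw [integral_const_mul] at h1
  simp only [Pi.add_apply] at h1
  rw [integral_add (integrable_const _) hi12, integral_add hi1 hi2, integral_const_mul,
    integral_const_mul, h.integral_inner_sub_mean,
    integral_finsetSum _ fun k _ => hgint k] at h1
  simp only [integral_const, probReal_univ, one_smul] at h1
  have h2 : ∑ k, ∫ ω, g k (dataMatrix X ω) ∂P ≤ 8 * Sig := by
    rw [hSig, Finset.mul_sum]
    exact Finset.sum_le_sum fun k _ => integral_overflow_extendedSpace_le h (S k) (hD k) (hL k) s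
  have hpenK : K ≤ pen m := by
    refine le_trans ?_ (hpen m)
    have h3 : (1 : ℝ) ≤ Module.finrank ℝ (S m) := by exact_mod_cast hD m
    have h4 : (1 : ℝ) ≤ (1 + 2 * Real.sqrt (2 * L m)) ^ 2 :=
      one_le_pow₀ (by linarith [Real.sqrt_nonneg (2 * L m)])
    nlinarith [mul_le_mul h3 h4 zero_le_one (by positivity)]
  set R := ∫ ω, ‖s - proj (S (mhat ω)) (dataMatrix X ω)‖ ^ 2 ∂P with hR
  set b := ‖s - proj (S m) s‖ ^ 2
  have hb : 0 ≤ b := sq_nonneg _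
  have hSig0 : 0 ≤ Sig := Finset.sum_nonneg fun k _ => (Real.exp_pos _).le
  have h3 : (K - 1) / (K + 1) * R ≤ (b + pen m + B / 2) + 16 * B * Sig := by
    have := mul_le_mul_of_nonneg_left h2 hB0.le
    linarith
  have h4 : R ≤ (K + 1) / (K - 1) * ((b + pen m + B / 2) + 16 * B * Sig) := by
    rw [div_mul_eq_mul_div, div_le_iff₀ (by linarith)] at h3
    rw [div_mul_eq_mul_div, le_div_iff₀ hK1]
    linarith
  -- The constant `B / 2` does not carry a factor `Sig`; it is absorbed by `pen m ≥ K`.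
  have h5 : B / 2 ≤ (K + 1) / (2 * (K - 1)) * (b + pen m) := by
    rw [hB]
    have : K * (K + 1) / (K - 1) / 2 = (K + 1) / (2 * (K - 1)) * K := by field_simp
    rw [this]
    gcongr
    linarith
  have h6 : (K + 1) / (K - 1) * (1 + (K + 1) / (2 * (K - 1))) ≤
      2 * K * (K + 1) ^ 2 / (K - 1) ^ 3 := by
    have : 2 * K * (K + 1) ^ 2 / (K - 1) ^ 3 -
        (K + 1) / (K - 1) * (1 + (K + 1) / (2 * (K - 1))) =
        (K + 1) * (K ^ 2 + 8 * K - 1) / (2 * (K - 1) ^ 3) := by field_simp; ring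
    have h7 : 0 ≤ (K + 1) * (K ^ 2 + 8 * K - 1) / (2 * (K - 1) ^ 3) := by
      have : 0 ≤ K ^ 2 + 8 * K - 1 := by nlinarith
      positivity
    linarith
  have h8 : (K + 1) / (K - 1) * (16 * B) ≤ 16 * K * ((K + 1) / (K - 1)) ^ 3 := by
    have h9 : 1 ≤ (K + 1) / (K - 1) := by rw [le_div_iff₀ hK1]; linarith
    have h10 : (K + 1) / (K - 1) * (16 * B) = 16 * K * ((K + 1) / (K - 1)) ^ 2 := by
      rw [hB]; field_simp
    rw [h10]
    gcongr
    norm_num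
  have h11 : 0 ≤ b + pen m := by linarith
  calc R ≤ _ := h4
    _ ≤ (K + 1) / (K - 1) * ((b + pen m + (K + 1) / (2 * (K - 1)) * (b + pen m)) +
        16 * B * Sig) := by gcongr
    _ = (K + 1) / (K - 1) * (1 + (K + 1) / (2 * (K - 1))) * (b + pen m) +
        (K + 1) / (K - 1) * (16 * B) * Sig := by ring
    _ ≤ _ := by gcongr

end MultinomialSelection

end

theorem theorem1 {Ω : Type*} [MeasurableSpace Ω] (P : Measure Ω) [IsProbabilityMeasure P]
    {r n : ℕ} (hr : 2 ≤ r)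
    (X : Fin n → Ω → Fin r → ℝ)
    (hX_meas : ∀ i, Measurable (X i))
    (hX_indep : iIndepFun X P)
    (hX_values : ∀ i ω j, X i ω j = 0 ∨ X i ω j = 1)
    (hX_sum : ∀ i ω, ∑ j, X i ω j = 1)
    {ι : Type*} [Fintype ι]
    (S : ι → Submodule ℝ (EuclideanSpace ℝ (Fin n)))
    (hD : ∀ m, 1 ≤ Module.finrank ℝ (S m))
    (pen : ι → ℝ) (hpen_nonneg : ∀ m, 0 ≤ pen m)
    (K : ℝ) (hK : 1 < K)
    (L : ι → ℝ) (hL : ∀ m, 0 < L m)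
    (hpen : ∀ m, K * (Module.finrank ℝ (S m) : ℝ) * (1 + 2 * Real.sqrt (2 * L m)) ^ 2 ≤ pen m)
    (mhat : Ω → ι)
    (hmhat_meas : ∀ m, MeasurableSet {ω | mhat ω = m})
    (hmhat : ∀ ω, MultinomialSelection.IsSelected S pen
      (MultinomialSelection.dataMatrix X ω) (mhat ω)) :
    Integrable (fun ω => ‖MultinomialSelection.meanMatrix P X -
      MultinomialSelection.proj (S (mhat ω)) (MultinomialSelection.dataMatrix X ω)‖ ^ 2) P ∧
    ∫ ω, ‖MultinomialSelection.meanMatrix P X -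
      MultinomialSelection.proj (S (mhat ω)) (MultinomialSelection.dataMatrix X ω)‖ ^ 2 ∂P ≤
      2 * K * (K + 1) ^ 2 / (K - 1) ^ 3 *
        (⨅ m, (‖MultinomialSelection.meanMatrix P X -
          MultinomialSelection.proj (S m) (MultinomialSelection.meanMatrix P X)‖ ^ 2 + pen m)) +
      16 * K * ((K + 1) / (K - 1)) ^ 3 *
        ∑ m, Real.exp (-(L m * (Module.finrank ℝ (S m) : ℝ))) := by
  have h : MultinomialSelection.IsCategoricalSample P X :=
    ⟨hX_meas, hX_indep, hX_values, hX_sum⟩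
  have hint : Integrable (fun ω => ‖MultinomialSelection.meanMatrix P X -
      MultinomialSelection.proj (S (mhat ω)) (MultinomialSelection.dataMatrix X ω)‖ ^ 2) P := by
    classical
    have h1 : ∀ m, Integrable ({ω | mhat ω = m}.indicator fun ω =>
        ‖MultinomialSelection.meanMatrix P X -
          MultinomialSelection.proj (S m) (MultinomialSelection.dataMatrix X ω)‖ ^ 2) P :=
      fun m => (h.integrable_comp (Φ := fun t => ‖MultinomialSelection.meanMatrix P X -
        MultinomialSelection.proj (S m) t‖ ^ 2) (by
          unfold MultinomialSelection.proj; fun_prop)).indicator (hmhat_meas m)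
    refine (integrable_finsetSum Finset.univ fun m _ => h1 m).congr
      (Filter.Eventually.of_forall fun ω => ?_)
    simp [Set.indicator_apply]
  have hne : Nonempty ι := by
    obtain ⟨ω⟩ := nonempty_of_isProbabilityMeasure P
    exact ⟨mhat ω⟩
  refine ⟨hint, ?_⟩
  obtain ⟨m, hm⟩ := exists_eq_ciInf_of_finite (f := fun m =>
    ‖MultinomialSelection.meanMatrix P X -
      MultinomialSelection.proj (S m) (MultinomialSelection.meanMatrix P X)‖ ^ 2 + pen m)
  rw [← hm]
  exact MultinomialSelection.integral_norm_sq_sub_proj_le h S hD pen K hK L hL hpen mhat hmhat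
    hint m
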